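/- Let $P$ be a poset such that $P_{\le p}=\{r\in P : r\le p\}$ is finite for every $p\in P$, and let $P$ be graded by $\dim:P\to\mathbb N$, i.e. $p<q$ implies $\dim p<\dim q$, $\dim p=0$ for every minimal $p$, and $\dim p=\dim q+1$ whenever $p$ covers $q$. Let $\hat P=P\sqcup\{\hat 0\}$ be $P$ with a minimum element $\hat 0$ adjoined, with $\dim\hat 0=-1$. A local covering family $\mathcal K$ for $P$ consists of subposets $K_p\subseteq\hat P_{\le p}$ and maps $\eta_p:K_p\to\hat P_{\le p}\setminus K_p$, for all $p\in P$, such that (1) $\hat 0\in K_p$; (2) if $q\in K_p$ then $q<\eta_p(q)$ and $\dim\eta_p(q)=\dim q+1$; (3) if $q\notin K_p$ and $q\le p$ then $\eta_p(\hat 0)=\eta_q(\hat 0)$; (4) if $q,r\in K_p$ and $q\le r$ then $\eta_p(q)\le\eta_p(r)$; (5) if $q\in K_p$, $r\notin K_p$ and $q\le r\le p$ then $\eta_p(q)\le r$. Write $P_n=\{p\in P:\dim p=n\}$ and $(K_p)_n=\{q\in K_p:\dim q=n\}$, and define numbers $K^p_n$ ($p\in P$, $n\ge 0$) by $K^p_0=1$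 and $K^p_{n+1}=\sum_{q\in(K_p)_n}K^q_n$. Theorem. Let $P$ be such a graded poset with a local covering family $\mathcal K$, and let $R$ be a commutative ring with identity. Then there is a chain complex of $R$-modules $$\cdots\to\bigoplus_{p\in P_n}R^{K^p_n}\to\cdots\to\bigoplus_{p\in P_1}R^{K^p_1}\to\bigoplus_{p\in P_0}R\to 0$$ whose homology is, in every degree $n\ge 0$, isomorphic to $H_n(|P|;R)$, the (unreduced) simplicial homology with coefficients in $R$ of the realization $|P|=|\Delta(P)|$, computed by the simplicial chain complex $C_*(\Delta(P);R)$ of the order complex $\Delta(P)$, with $C_n(\Delta(P);R)=\bigoplus_{p_0<\cdots<p_n}R$ and $\partial=\sum_i(-1)^i\partial_i$, where $\partial_i$ omits $p_i$. -/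

import Mathlib

open CategoryTheory
open scoped DirectSum

universe u v

/-- The dimension function on `P̂ = WithBot P`, the poset `P` with a minimum element `0̂ = ⊥`
adjoined: it extends the grading of `P` by `dim 0̂ = -1`. -/
def hatDim {P : Type u} [PartialOrder P] [GradeMinOrder ℕ P] : WithBot P → ℤ
  | ⊥ => -1
  | (p : P) => (grade ℕ p : ℤ)

/-- A local covering family for a graded poset `P`: subposets `K p` of `P̂_{≤ p}` and maps
`η p : K p → P̂_{≤ p} \ K p`, for all `p : P`, subject to the five compatibility conditions
`bot_mem`, `lt_η` together with `dim_η`, `η_bot`, `η_mono` and `η_le`. -/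
structure LocalCoveringFamily (P : Type u) [PartialOrder P] [GradeMinOrder ℕ P] where
  /-- The subposet `K_p`. -/
  K : P → Set (WithBot P)
  K_subset : ∀ p : P, K p ⊆ Set.Iic (p : WithBot P)
  /-- The map `η_p : K_p → P̂_{≤ p} \ K_p`. -/
  η : ∀ p : P, K p → ↥(Set.Iic (p : WithBot P) \ K p)
  bot_mem : ∀ p : P, ⊥ ∈ K p
  lt_η : ∀ (p : P) (q : K p), (q : WithBot P) < (η p q : WithBot P)
  dim_η : ∀ (p : P) (q : K p), hatDim (η p q : WithBot P) = hatDim (q : WithBot P) + 1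
  η_bot : ∀ p q : P, (q : WithBot P) ∉ K p → q ≤ p →
    (η p ⟨⊥, bot_mem p⟩ : WithBot P) = (η q ⟨⊥, bot_mem q⟩ : WithBot P)
  η_mono : ∀ (p : P) (q r : K p), (q : WithBot P) ≤ (r : WithBot P) →
    (η p q : WithBot P) ≤ (η p r : WithBot P)
  η_le : ∀ (p : P) (q : K p) (r : WithBot P), r ∉ K p → (q : WithBot P) ≤ r →
    r ≤ (p : WithBot P) → (η p q : WithBot P) ≤ r

/-- The numbers `K^p_n`: `K^p_0 = 1` and `K^p_{n+1}` is the sum of `K^q_n` over the elements `q`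
of dimension `n` in `K_p` (a finite set when all the rays `P_{≤ p}` are finite). -/
noncomputable def LocalCoveringFamily.num {P : Type u} [PartialOrder P] [GradeMinOrder ℕ P]
    (𝒦 : LocalCoveringFamily P) : ℕ → P → ℕ
  | 0, _ => 1
  | n + 1, p => ∑ᶠ q ∈ {q : P | (q : WithBot P) ∈ 𝒦.K p ∧ grade ℕ q = n}, 𝒦.num n q

namespace OrderComplex

/-- The `n`-simplices of the order complex `Δ(P)`: chains `p_0 < ⋯ < p_n` in `P`. -/
abbrev Simplex (P : Type u) [PartialOrder P] (n : ℕ) : Type u := Fin (n + 1) ↪o P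

/-- The `i`-th face of `p_0 < ⋯ < p_{n+1}`, obtained by omitting `p_i`. -/
def face {P : Type u} [PartialOrder P] {n : ℕ} (i : Fin (n + 2)) (c : Simplex P (n + 1)) :
    Simplex P n :=
  (Fin.succAboveOrderEmb i).trans c

/-- The simplicial boundary map `∂ = ∑ (-1)^i ∂_i`. -/
noncomputable def boundary (P : Type u) [PartialOrder P] (R : Type v) [CommRing R] (n : ℕ) :
    (Simplex P (n + 1) →₀ R) →ₗ[R] (Simplex P n →₀ R) :=
  ∑ i : Fin (n + 2), (-1 : R) ^ (i : ℕ) • Finsupp.lmapDomain R R (face i)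

theorem face_face {P : Type u} [PartialOrder P] {n : ℕ} {i : Fin (n + 2)} {j : Fin (n + 3)}
    (hij : (j : ℕ) ≤ i) (h : (j : ℕ) < n + 2) (c : Simplex P (n + 2)) :
    face i (face j c) = face (Fin.castLT j h) (face i.succ c) := by
  apply DFunLike.ext
  intro k
  change c (j.succAbove (i.succAbove k)) = c (i.succ.succAbove ((Fin.castLT j h).succAbove k))
  congr 1
  ext
  simp only [Fin.succAbove, Fin.lt_def, Fin.val_castSucc, Fin.val_succ, Fin.val_castLT]
  split_ifs <;> simp_all <;> omega

theorem boundary_boundary (P : Type u) [PartialOrder P] (R : Type v) [CommRing R] (n : ℕ) :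
    boundary P R n ∘ₗ boundary P R (n + 1) = 0 := by
  apply Finsupp.lhom_ext
  intro c a
  simp only [boundary, LinearMap.comp_apply, LinearMap.sum_apply, LinearMap.smul_apply,
    Finsupp.lmapDomain_apply, Finsupp.mapDomain_single, map_sum, map_smul, Finset.smul_sum,
    LinearMap.zero_apply, smul_smul]
  rw [Finset.sum_comm, ← Finset.sum_product']
  let S : Finset (Fin (n + 2) × Fin (n + 3)) := {ij | (ij.2 : ℕ) ≤ (ij.1 : ℕ)}
  rw [Finset.univ_product_univ, ← Finset.sum_add_sum_compl S, ← eq_neg_iff_add_eq_zero,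
    ← Finset.sum_neg_distrib]
  let φ : ∀ ij : Fin (n + 2) × Fin (n + 3), ij ∈ S → Fin (n + 2) × Fin (n + 3) := fun ij hij =>
    (Fin.castLT ij.2 (lt_of_le_of_lt (Finset.mem_filter.mp hij).right (Fin.is_lt ij.1)), ij.1.succ)
  apply Finset.sum_bij φ
  · intro ij hij
    simp_rw [S, φ, Finset.compl_filter, Finset.mem_filter_univ, Fin.val_succ,
      Fin.val_castLT] at hij ⊢
    lia
  · rintro ⟨i, j⟩ hij ⟨i', j'⟩ hij' h
    simp only [φ, Prod.mk_inj, Fin.ext_iff, Fin.val_castLT, Fin.val_succ] at h ⊢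
    omega
  · rintro ⟨i', j'⟩ hij'
    simp_rw [S, Finset.compl_filter, Finset.mem_filter_univ, not_le] at hij'
    refine ⟨(j'.pred ?_, Fin.castSucc i'), ?_, ?_⟩
    · rintro rfl
      simp only [Fin.val_zero, not_lt_zero] at hij'
    · simp only [S, Finset.mem_filter_univ, Fin.val_castSucc, Fin.val_pred]
      omega
    · simp only [φ, Fin.castLT_castSucc, Fin.succ_pred]
  · rintro ⟨i, j⟩ hij
    have h : (j : ℕ) ≤ i := by simpa [S] using hij
    simp only [φ]
    rw [face_face h (lt_of_le_of_lt h i.is_lt), ← neg_smul]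
    congr 1
    simp only [Fin.val_succ, Fin.val_castLT, pow_succ]
    ring

/-- The simplicial chain complex `C_*(Δ(P); R)` of the order complex of `P`. -/
noncomputable def chainComplex (P : Type u) [PartialOrder P] (R : Type v) [CommRing R] :
    ChainComplex (ModuleCat.{max u v} R) ℕ :=
  ChainComplex.of (fun n => ModuleCat.of R (Simplex P n →₀ R))
    (fun n => ModuleCat.ofHom (boundary P R n))
    (fun n => by rw [← ModuleCat.ofHom_comp, boundary_boundary]; rfl)

/-- `H_n(|P|; R)`, the simplicial homology of the realization `|P| = |Δ(P)|`. -/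
noncomputable abbrev homology (P : Type u) [PartialOrder P] (R : Type v) [CommRing R] (n : ℕ) :
    ModuleCat.{max u v} R :=
  (chainComplex P R).homology n

end OrderComplex

/-! The dimension filtration of `Δ(P)` behaves like the skeletal filtration of a CW complex: each
`P_{<p}` has the reduced homology of a wedge of `K^p_n` spheres of dimension `n - 1`, where `n = dim
p`. The required complex is the cellular complex of this filtration. For the local statement, let
`dim p = n + 1` and let `A` be `P_{<p}` without the `n`-dimensional elements of `K_p`. Extending
`η_p` by the identity gives a monotone map `f ≥ id` on `A` whose values lie above `η_p(0̂)`, so `A`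
is acyclic (`exists_closure`, `DescChain.exists_primitive`). The removed elements `q` are maximal in
`P_{<p}`, and restoring one attaches a cone over `P_{<q}`. By induction, homology below the top
degree vanishes (`exists_boundary_eq`) and the top cycles of `P_{<p}` are the direct sum of those of
the `P_{<q}` (`nonempty_topCycles_equiv_directSum`), which is the recursion defining `K^p_n`.
Globally, an `n`-cellular chain splits into top cycles of `P_{<p}` with `dim p = n`. The local
vanishing lets chains be pushed down the filtration modulo boundaries, so the inclusion of cellular
into simplicial chains induces isomorphisms in homology. Chains are encoded as decreasing lists,
with the largest element at the head. The index `k` counts vertices, so it stands for degree `k -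
1`, and the empty list supplies the augmentation. -/

namespace DescChain

section Support

variable {α R M : Type*} [CommRing R] [AddCommGroup M] [Module R M]

theorem map_mem_of_supported {s : Set α} {N : Submodule R M} (f : (α →₀ R) →ₗ[R] M)
    (h : ∀ a ∈ s, f (Finsupp.single a 1) ∈ N) {x : α →₀ R} (hx : x ∈ Finsupp.supported R R s) :
    f x ∈ N := by
  have : Finsupp.supported R R s ≤ N.comap f := by
    rw [Finsupp.supported_eq_span_single, Submodule.span_le]
    rintro _ ⟨a, ha, rfl⟩
    exact h a ha
  exact this hx

theorem map_eq_of_supported {s : Set α} {f g : (α →₀ R) →ₗ[R] M}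
    (h : ∀ a ∈ s, f (Finsupp.single a 1) = g (Finsupp.single a 1)) {x : α →₀ R}
    (hx : x ∈ Finsupp.supported R R s) : f x = g x := by
  have := map_mem_of_supported (N := ⊥) (f - g) (s := s)
    (fun a ha => by simp [h a ha]) hx
  simpa [sub_eq_zero] using this

theorem single_mem_supported {s : Set α} {a : α} (ha : a ∈ s) :
    (Finsupp.single a 1 : α →₀ R) ∈ Finsupp.supported R R s :=
  Finsupp.single_mem_supported R _ ha

end Support

/-! ### Formal sums of lists and their augmented boundary -/

variable {P : Type u} {R : Type v} [CommRing R]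

/-- The linear extension of `l ↦ a :: l`. -/
noncomputable def cons (R : Type v) [CommRing R] (a : P) : (List P →₀ R) →ₗ[R] (List P →₀ R) :=
  Finsupp.lmapDomain R R (List.cons a)

@[simp]
theorem cons_single (a : P) (l : List P) (r : R) :
    cons R a (Finsupp.single l r) = Finsupp.single (a :: l) r := by
  simp [cons]

/-- The coefficient of a formal sum of lists at the head `a`. -/
noncomputable def tail (R : Type v) [CommRing R] (a : P) : (List P →₀ R) →ₗ[R] (List P →₀ R) :=
  Finsupp.lcomapDomain (List.cons a) (List.cons_injective)

theorem tail_apply (a : P) (x : List P →₀ R) (l : List P) : tail R a x l = x (a :: l) := rfl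

@[simp]
theorem tail_cons (a : P) (x : List P →₀ R) : tail R a (cons R a x) = x := by
  ext l
  simp [tail_apply, cons, Finsupp.mapDomain_apply List.cons_injective]

theorem tail_single_of_head?_ne {a : P} {l : List P} (h : l.head? ≠ some a) (r : R) :
    tail R a (Finsupp.single l r) = 0 := by
  ext l'
  rw [tail_apply, Finsupp.single_eq_of_ne]
  · rfl
  · rintro rfl
    simp at h

theorem tail_cons_of_ne {a b : P} (h : a ≠ b) (x : List P →₀ R) :
    tail R a (cons R b x) = 0 := by
  have : tail R a ∘ₗ cons R b = 0 := by
    apply Finsupp.lhom_ext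
    intro l r
    simp only [LinearMap.comp_apply, cons_single]
    exact tail_single_of_head?_ne (by simpa using h.symm) r
  exact LinearMap.congr_fun this x

/-- The boundary of a list, with the head omitted first. -/
noncomputable def boundaryList (R : Type v) [CommRing R] : List P → (List P →₀ R)
  | [] => 0
  | a :: l => Finsupp.single l 1 - cons R a (boundaryList R l)

/-- The augmented simplicial boundary on formal sums of lists. -/
noncomputable def boundary (R : Type v) [CommRing R] : (List P →₀ R) →ₗ[R] (List P →₀ R) :=
  Finsupp.linearCombination R (boundaryList R)

@[simp]
theorem boundary_single_nil : boundary R (Finsupp.single ([] : List P) 1) = 0 := by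
  simp [boundary, boundaryList]

theorem boundary_cons (a : P) (x : List P →₀ R) :
    boundary R (cons R a x) = x - cons R a (boundary R x) := by
  have : boundary R ∘ₗ cons R a = LinearMap.id - cons R a ∘ₗ boundary R := by
    apply Finsupp.lhom_ext'
    intro l
    ext1
    simp [boundary, boundaryList]
  exact LinearMap.congr_fun this x

theorem boundary_boundary (x : List P →₀ R) : boundary R (boundary R x) = 0 := by
  have : boundary R ∘ₗ boundary R = (0 : (List P →₀ R) →ₗ[R] (List P →₀ R)) := by
    apply Finsupp.lhom_ext'
    intro l
    ext1
    simp only [LinearMap.comp_apply, Finsupp.lsingle_apply, LinearMap.zero_apply]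
    induction l with
    | nil => simp
    | cons a l ih =>
      rw [← cons_single, boundary_cons, map_sub, boundary_cons, ih]
      simp
  exact LinearMap.congr_fun this x

theorem boundary_single_mem (l : List P) :
    boundary R (Finsupp.single l 1) ∈
      Finsupp.supported R R {l' | l'.Sublist l ∧ l'.length + 1 = l.length} := by
  induction l with
  | nil => simp
  | cons a l ih =>
    rw [← cons_single, boundary_cons]
    refine sub_mem (single_mem_supported ⟨List.sublist_cons_self a l, rfl⟩)
      (map_mem_of_supported (cons R a) ?_ ih)
    rintro l' ⟨h₁, h₂⟩
    rw [cons_single]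
    exact single_mem_supported ⟨h₁.cons_cons a, by simpa using h₂⟩

open Classical in
/-- The cone with apex `t`, on formal sums of chains all of whose entries are at most `t`. -/
noncomputable def cone (R : Type v) [CommRing R] (t : P) :
    (List P →₀ R) →ₗ[R] (List P →₀ R) :=
  Finsupp.linearCombination R
    fun l => if l.head? = some t then 0 else Finsupp.single (t :: l) 1

theorem cone_single_cons_self (t : P) (l : List P) :
    cone R t (Finsupp.single (t :: l) 1) = 0 := by
  simp [cone]

/-! ### Chains of a poset as strictly decreasing lists -/

variable [PartialOrder P]

/-- The strictly decreasing lists of length `k` with entries in `B`. -/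
def descLists (B : Set P) (k : ℕ) : Set (List P) :=
  {l | l.Pairwise (· > ·) ∧ (∀ a ∈ l, a ∈ B) ∧ l.length = k}

/-- The free module on strictly decreasing lists of length `k` with entries in `B`. -/
noncomputable abbrev chains (R : Type v) [CommRing R] (B : Set P) (k : ℕ) :
    Submodule R (List P →₀ R) :=
  Finsupp.supported R R (descLists B k)

theorem descLists_mono {B B' : Set P} (h : B ⊆ B') (k : ℕ) : descLists B k ⊆ descLists B' k :=
  fun _ hl => ⟨hl.1, fun a ha => h (hl.2.1 a ha), hl.2.2⟩

theorem chains_mono {B B' : Set P} (h : B ⊆ B') (k : ℕ) : chains R B k ≤ chains R B' k :=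
  Finsupp.supported_mono (descLists_mono h k)

theorem descLists_zero (B : Set P) : descLists B 0 = {[]} := by
  ext l
  simp only [descLists, List.length_eq_zero_iff, Set.mem_ofPred_eq, Set.mem_singleton_iff]
  constructor
  · exact fun h => h.2.2
  · rintro rfl
    simp

theorem chains_zero_eq (B B' : Set P) : chains R B 0 = chains R B' 0 := by
  rw [chains, chains, descLists_zero, descLists_zero]

theorem cons_mem_descLists {B : Set P} {k : ℕ} {a : P} {l : List P} :
    a :: l ∈ descLists B (k + 1) ↔ a ∈ B ∧ l ∈ descLists (B ∩ Set.Iio a) k := by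
  simp only [descLists, Set.mem_ofPred_eq, List.pairwise_cons, List.mem_cons, forall_eq_or_imp,
    List.length_cons, Set.mem_inter_iff, Set.mem_Iio]
  constructor
  · rintro ⟨⟨h₁, h₂⟩, ⟨h₃, h₄⟩, h₅⟩
    exact ⟨h₃, h₂, fun b hb => ⟨h₄ b hb, h₁ b hb⟩, by omega⟩
  · rintro ⟨h₃, h₂, h, h₅⟩
    exact ⟨⟨fun b hb => (h b hb).2, h₂⟩, ⟨h₃, fun b hb => (h b hb).1⟩, by omega⟩

theorem cons_mem_chains {B : Set P} {k : ℕ} {a : P} (ha : a ∈ B) {x : List P →₀ R}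
    (hx : x ∈ chains R (B ∩ Set.Iio a) k) : cons R a x ∈ chains R B (k + 1) := by
  refine map_mem_of_supported (cons R a) (fun l hl => ?_) hx
  rw [cons_single]
  exact single_mem_supported (cons_mem_descLists.2 ⟨ha, hl⟩)

theorem tail_mem_chains {B : Set P} {k : ℕ} (a : P) {x : List P →₀ R}
    (hx : x ∈ chains R B (k + 1)) : tail R a x ∈ chains R (B ∩ Set.Iio a) k := by
  rw [Finsupp.mem_supported'] at hx ⊢
  intro l hl
  rw [tail_apply]
  exact hx _ fun h => hl (cons_mem_descLists.1 h).2

theorem tail_eq_zero_of_notMem {B : Set P} {k : ℕ} {a : P} (ha : a ∉ B) {x : List P →₀ R}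
    (hx : x ∈ chains R B k) : tail R a x = 0 := by
  rw [Finsupp.mem_supported'] at hx
  ext l
  rw [tail_apply]
  exact hx _ fun h => ha (h.2.1 a (by simp))

theorem boundary_mem_chains {B : Set P} {k : ℕ} {x : List P →₀ R}
    (hx : x ∈ chains R B (k + 1)) : boundary R x ∈ chains R B k := by
  refine map_mem_of_supported (boundary R) (fun l hl => ?_) hx
  refine Finsupp.supported_mono ?_ (boundary_single_mem l)
  rintro l' ⟨h₁, h₂⟩
  refine ⟨hl.1.sublist h₁, fun a ha => hl.2.1 a (h₁.subset ha), ?_⟩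
  have := hl.2.2
  omega

theorem boundary_eq_zero_of_mem_chains_zero {B : Set P} {x : List P →₀ R}
    (hx : x ∈ chains R B 0) : boundary R x = 0 := by
  refine map_eq_of_supported (f := boundary R) (g := 0) (fun l hl => ?_) hx
  rw [descLists_zero, Set.mem_singleton_iff] at hl
  simp [hl]

/-! ### Contractible posets -/

theorem cone_single_of_forall_lt {t : P} {l : List P} (h : ∀ a ∈ l, a < t) :
    cone R t (Finsupp.single l 1) = Finsupp.single (t :: l) 1 := by
  rw [cone, Finsupp.linearCombination_single, one_smul, if_neg]
  intro h'
  exact lt_irrefl t (h t (List.mem_of_head? h'))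

theorem eq_cons_or_forall_lt {B : Set P} {t : P} {k : ℕ} {l : List P}
    (hl : l ∈ descLists (B ∩ Set.Iic t) k) :
    (∃ l', l = t :: l' ∧ ∀ a ∈ l', a < t) ∨ ∀ a ∈ l, a < t := by
  obtain ⟨h₁, h₂, -⟩ := hl
  cases l with
  | nil => simp
  | cons b l =>
    rw [List.pairwise_cons] at h₁
    by_cases hb : b = t
    · subst hb
      exact Or.inl ⟨l, rfl, h₁.1⟩
    · have hlt : b < t := lt_of_le_of_ne (h₂ b (by simp)).2 hb
      right
      intro a ha
      rcases List.mem_cons.1 ha with rfl | ha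
      · exact hlt
      · exact (h₁.1 a ha).trans hlt

theorem cone_mem_chains {B : Set P} {t : P} (ht : t ∈ B) {k : ℕ} {x : List P →₀ R}
    (hx : x ∈ chains R (B ∩ Set.Iic t) k) :
    cone R t x ∈ chains R (B ∩ Set.Iic t) (k + 1) := by
  refine map_mem_of_supported (cone R t) (fun l hl => ?_) hx
  rcases eq_cons_or_forall_lt hl with ⟨l', rfl, -⟩ | h
  · rw [cone_single_cons_self]
    exact zero_mem _
  · rw [cone_single_of_forall_lt h]
    exact single_mem_supported (cons_mem_descLists.2
      ⟨⟨ht, le_refl t⟩, hl.1, fun a ha => ⟨hl.2.1 a ha, h a ha⟩, hl.2.2⟩)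

theorem cone_eq_cons {s : Set (List P)} {t : P} (hs : ∀ l ∈ s, ∀ a ∈ l, a < t)
    {x : List P →₀ R} (hx : x ∈ Finsupp.supported R R s) : cone R t x = cons R t x :=
  map_eq_of_supported (fun l hl => by rw [cone_single_of_forall_lt (hs l hl), cons_single]) hx

/-- The usual cone formula also holds on chains already headed by `t`: both `t :: l` and `t :: ∂l`
are killed, and the surviving term `cone l = t :: l` cancels the chain itself. -/
theorem boundary_cone {B : Set P} {t : P} {k : ℕ} {x : List P →₀ R}
    (hx : x ∈ chains R (B ∩ Set.Iic t) k) :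
    boundary R (cone R t x) = x - cone R t (boundary R x) := by
  refine map_eq_of_supported (f := boundary R ∘ₗ cone R t)
    (g := LinearMap.id - cone R t ∘ₗ boundary R) (fun l hl => ?_) hx
  simp only [LinearMap.comp_apply, LinearMap.sub_apply, LinearMap.id_apply]
  have key : ∀ l' : List P, (∀ a ∈ l', a < t) → cone R t (boundary R (Finsupp.single l' 1)) =
      cons R t (boundary R (Finsupp.single l' 1)) := fun l' h =>
    cone_eq_cons (fun l'' h'' a ha => h a (h''.1.subset ha)) (boundary_single_mem l')
  rcases eq_cons_or_forall_lt hl with ⟨l', rfl, h⟩ | h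
  · have h0 : cone R t (cons R t (boundary R (Finsupp.single l' 1))) = 0 := by
      have : cone R t ∘ₗ cons R t = 0 := by
        apply Finsupp.lhom_ext'
        intro l
        ext1
        simp [cone_single_cons_self]
      exact LinearMap.congr_fun this _
    rw [cone_single_cons_self, ← cons_single, boundary_cons, map_sub, h0,
      cone_single_of_forall_lt h]
    simp
  · rw [cone_single_of_forall_lt h, key l h, ← cons_single, boundary_cons]

/-- A poset `A` with a monotone self-map `f ≥ id` whose image lies above `v` has vanishing reduced
homology; moreover, a primitive of a cycle can be chosen linearly. -/
theorem exists_primitive {A : Set P} {f : P → P} {v : P} (hv : v ∈ A)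
    (hfA : ∀ a ∈ A, f a ∈ A) (hle : ∀ a ∈ A, a ≤ f a)
    (hmono : ∀ a ∈ A, ∀ b ∈ A, a ≤ b → f a ≤ f b) (hvf : ∀ a ∈ A, v ≤ f a) (k : ℕ) :
    ∃ H : (List P →₀ R) →ₗ[R] (List P →₀ R),
      (∀ x ∈ chains R A k, H x ∈ chains R A (k + 1)) ∧
      ∀ x ∈ chains R A k, boundary R x = 0 → boundary R (H x) = x := by
  -- The extra first clause is an acyclic carrier condition: a chain below `a` is filled below `f
  -- a`. It keeps the induction going.
  suffices h : ∃ H : (List P →₀ R) →ₗ[R] (List P →₀ R),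
      (∀ a ∈ A, ∀ x ∈ chains R (A ∩ Set.Iic a) k,
        H x ∈ chains R (A ∩ Set.Iic (f a)) (k + 1)) ∧
      (∀ x ∈ chains R A k, H x ∈ chains R A (k + 1)) ∧
      ∀ x ∈ chains R A k, boundary R x = 0 → boundary R (H x) = x by
    obtain ⟨H, -, h₁, h₂⟩ := h
    exact ⟨H, h₁, h₂⟩
  induction k with
  | zero =>
    have hmem : ∀ B : Set P, v ∈ B → ∀ B' : Set P, ∀ x ∈ chains R B' 0,
        cons R v x ∈ chains R B 1 := fun B hB B' x hx =>
      cons_mem_chains hB (chains_zero_eq (R := R) B' (B ∩ Set.Iio v) ▸ hx)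
    refine ⟨cons R v, fun a ha x hx => hmem (A ∩ Set.Iic (f a)) ⟨hv, hvf a ha⟩ _ x hx, fun x hx =>
      hmem _ hv _ x hx, fun x _ hx => ?_⟩
    rw [boundary_cons, hx]
    simp
  | succ k ih =>
    obtain ⟨H, hH₁, hH₂, hH₃⟩ := ih
    -- For a chain `l` with head `a`, `l - H (∂l)` is a cycle lying below `f a`, by `a ≤ f a` and
    -- the carrier condition. Coning it off with apex `f a` gives `∂ (H' l) = l - H (∂l)`.
    let H' : (List P →₀ R) →ₗ[R] (List P →₀ R) := Finsupp.linearCombination R fun l =>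
      l.head?.elim 0 fun a =>
        cone R (f a) (Finsupp.single l 1 - H (boundary R (Finsupp.single l 1)))
    have hH' : ∀ a l, H' (Finsupp.single (a :: l) 1) = cone R (f a)
        (Finsupp.single (a :: l) 1 - H (boundary R (Finsupp.single (a :: l) 1))) := by
      intro a l
      simp [H']
    have hz : ∀ a l, a :: l ∈ descLists A (k + 1) →
        Finsupp.single (a :: l) 1 - H (boundary R (Finsupp.single (a :: l) 1)) ∈
          chains R (A ∩ Set.Iic (f a)) (k + 1) := by
      intro a l hl
      have hl' := cons_mem_descLists.1 hl
      have hmem : (Finsupp.single (a :: l) 1 : List P →₀ R) ∈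
          chains R (A ∩ Set.Iic a) (k + 1) :=
        single_mem_supported (cons_mem_descLists.2 ⟨⟨hl'.1, le_refl a⟩,
          descLists_mono (B' := A ∩ Set.Iic a ∩ Set.Iio a)
            (fun b hb => ⟨⟨hb.1, le_of_lt hb.2⟩, hb.2⟩) k hl'.2⟩)
      refine sub_mem (chains_mono (Set.inter_subset_inter_right A
        (Set.Iic_subset_Iic.2 (hle a hl'.1))) _ hmem) ?_
      exact hH₁ a hl'.1 _ (boundary_mem_chains hmem)
    refine ⟨H', ?_, ?_, ?_⟩
    · intro a ha x hx
      refine map_mem_of_supported H' (fun l hl => ?_) hx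
      cases l with
      | nil => exact absurd hl.2.2 (by simp)
      | cons b l =>
        have hb := hl.2.1 b (by simp)
        rw [hH']
        exact chains_mono (Set.inter_subset_inter_right A
            (Set.Iic_subset_Iic.2 (hmono b hb.1 a ha hb.2))) _
          (cone_mem_chains (R := R) (hfA b hb.1)
            (hz b l (descLists_mono Set.inter_subset_left _ hl)))
    · intro x hx
      refine map_mem_of_supported H' (fun l hl => ?_) hx
      cases l with
      | nil => exact absurd hl.2.2 (by simp)
      | cons b l =>
        have hb := hl.2.1 b (by simp)
        rw [hH']
        exact chains_mono Set.inter_subset_left _ (cone_mem_chains (hfA b hb) (hz b l hl))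
    · intro x hx hx0
      have : boundary R (H' x) = x - H (boundary R x) := by
        refine map_eq_of_supported (f := boundary R ∘ₗ H')
          (g := LinearMap.id - H ∘ₗ boundary R) (fun l hl => ?_) hx
        cases l with
        | nil => exact absurd hl.2.2 (by simp)
        | cons b l =>
          simp only [LinearMap.comp_apply, LinearMap.sub_apply, LinearMap.id_apply]
          rw [hH', boundary_cone (hz b l hl), map_sub (boundary R),
            hH₃ _ (boundary_mem_chains (single_mem_supported hl)) (boundary_boundary _)]
          simp
      rw [this, hx0]
      simp

end DescChain

/-! ### Attaching cones at maximal elements -/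

namespace DescChain

variable {P : Type u} {R : Type v} [CommRing R]

theorem finite_tail_ne_zero (x : List P →₀ R) : {q : P | tail R q x ≠ 0}.Finite := by
  have : {q : P | tail R q x ≠ 0} ⊆ some ⁻¹' (List.head? '' (x.support : Set (List P))) := by
    intro q hq
    obtain ⟨l, hl⟩ := Finsupp.ne_iff.1 hq
    exact ⟨q :: l, by simpa [tail_apply] using hl, rfl⟩
  exact ((x.support.finite_toSet.image _).preimage (Option.some_injective P).injOn).subset this

open Classical in
theorem tail_sum_cons (s : Finset P) (y : P → List P →₀ R) (q : P) :
    tail R q (∑ q' ∈ s, cons R q' (y q')) = if q ∈ s then y q else 0 := by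
  rw [map_sum, ← Finset.sum_ite_eq s q y]
  refine Finset.sum_congr rfl fun q' _ => ?_
  split_ifs with h
  · subst h
    simp
  · exact tail_cons_of_ne h _

variable [PartialOrder P]

/-- Since nothing in `B` exceeds `q`, it can only occur as a head, so omitting a head never yields a
list headed by `q`. Only omissions inside the tail contribute, with one sign change. -/
theorem tail_boundary {B : Set P} {q : P} (hq : ∀ b ∈ B, ¬ q < b) {k : ℕ} {x : List P →₀ R}
    (hx : x ∈ chains R B k) : tail R q (boundary R x) = -boundary R (tail R q x) := by
  refine map_eq_of_supported (f := tail R q ∘ₗ boundary R)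
    (g := -(boundary R ∘ₗ tail R q)) (fun l hl => ?_) hx
  simp only [LinearMap.comp_apply, LinearMap.neg_apply]
  cases l with
  | nil => rw [tail_single_of_head?_ne (by simp)]; simp
  | cons a l =>
    have hl' : tail R q (Finsupp.single l 1) = 0 := by
      refine tail_single_of_head?_ne (fun h => hq a (hl.2.1 a (by simp)) ?_) 1
      exact (List.pairwise_cons.1 hl.1).1 q (List.mem_of_head? h)
    rw [← cons_single, boundary_cons, map_sub, hl', zero_sub]
    by_cases h : q = a
    · subst h
      rw [tail_cons, tail_cons]
    · rw [tail_cons_of_ne h, tail_cons_of_ne h, map_zero]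

theorem mem_chains_of_tail_eq_zero {B T : Set P} (hT : ∀ q ∈ T, ∀ b ∈ B ∪ T, ¬ q < b) {k : ℕ}
    {x : List P →₀ R} (hx : x ∈ chains R (B ∪ T) k) (h : ∀ q ∈ T, tail R q x = 0) :
    x ∈ chains R B k := by
  intro l hl
  have hl' := hx hl
  refine ⟨hl'.1, fun a ha => (hl'.2.1 a ha).resolve_right fun haT => ?_, hl'.2.2⟩
  cases l with
  | nil => simp at ha
  | cons b l =>
    rcases List.mem_cons.1 ha with rfl | ha
    · have := DFunLike.congr_fun (h a haT) l
      rw [tail_apply] at this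
      exact (Finsupp.mem_support_iff.1 hl) this
    · exact hT a haT b (hl'.2.1 b (by simp)) ((List.pairwise_cons.1 hl'.1).1 a ha)

/-- If `T` consists of maximal elements of `B ∪ T` below which the reduced homology vanishes in
degree `k`, then relative cycles of `(B ∪ T, B)` with `k + 1` vertices are relative boundaries. -/
theorem exists_sub_boundary_mem {B T : Set P} (hT : ∀ q ∈ T, ∀ b ∈ B ∪ T, ¬ q < b)
    (hqB : ∀ q ∈ T, q ∉ B)
    (hB : ∀ q ∈ T, Set.Iio q ⊆ B) {k : ℕ}
    (hex : ∀ q ∈ T, ∀ z ∈ chains R (Set.Iio q) k, boundary R z = 0 →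
      ∃ y ∈ chains R (Set.Iio q) (k + 1), boundary R y = z)
    {x : List P →₀ R} (hx : x ∈ chains R (B ∪ T) (k + 1)) (hbx : boundary R x ∈ chains R B k) :
    ∃ y ∈ chains R (B ∪ T) (k + 2), x - boundary R y ∈ chains R B (k + 1) := by
  classical
  have hcyc : ∀ q ∈ T, ∃ y ∈ chains R (Set.Iio q) (k + 1), boundary R y = tail R q x := by
    intro q hq
    refine hex q hq _ (chains_mono Set.inter_subset_right _ (tail_mem_chains q hx)) ?_
    rw [← neg_eq_zero, ← tail_boundary (hT q hq) hx]
    exact tail_eq_zero_of_notMem (hqB q hq) hbx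
  choose! y hy hby using hcyc
  have hfin : {q ∈ T | tail R q x ≠ 0}.Finite :=
    (finite_tail_ne_zero x).subset fun q hq => hq.2
  let w := ∑ q ∈ hfin.toFinset, cons R q (y q)
  have hw : w ∈ chains R (B ∪ T) (k + 2) := by
    refine sum_mem fun q hq => ?_
    have hq' := (hfin.mem_toFinset.1 hq).1
    have hsub : Set.Iio q ⊆ (B ∪ T) ∩ Set.Iio q := fun b hb => ⟨Or.inl (hB q hq' hb), hb⟩
    exact cons_mem_chains (Set.mem_union_right B hq') (chains_mono hsub _ (hy q hq'))
  refine ⟨-w, neg_mem hw, mem_chains_of_tail_eq_zero hT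
    (sub_mem hx (boundary_mem_chains (neg_mem hw))) fun q hq => ?_⟩
  rw [map_neg, sub_neg_eq_add, map_add, tail_boundary (hT q hq) hw, tail_sum_cons]
  split_ifs with h
  · rw [hby q hq, add_neg_cancel]
  · have : tail R q x = 0 := by
      by_contra h'
      exact h (hfin.mem_toFinset.2 ⟨hq, h'⟩)
    simp [this]

end DescChain

/-- A module with a family of compatible sections and retractions onto modules `Z i`, jointly
injective and with only finitely many nonzero components on each element, is their direct sum. -/
theorem nonempty_linearEquiv_directSum {R ι N : Type*} [CommRing R] [AddCommGroup N] [Module R N]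
    {Z : ι → Type*} [∀ i, AddCommGroup (Z i)] [∀ i, Module R (Z i)]
    (g : ∀ i, Z i →ₗ[R] N) (t : ∀ i, N →ₗ[R] Z i) (htg : ∀ i z, t i (g i z) = z)
    (htg' : ∀ i j, i ≠ j → ∀ z, t i (g j z) = 0) (hinj : ∀ x, (∀ i, t i x = 0) → x = 0)
    (hfin : ∀ x, {i | t i x ≠ 0}.Finite) : Nonempty (N ≃ₗ[R] ⨁ i, Z i) := by
  classical
  let G : (⨁ i, Z i) →ₗ[R] N := DirectSum.toModule R ι N g
  have hG : ∀ i x, t i (G x) = x i := by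
    intro i x
    have : t i ∘ₗ G = DirectSum.component R ι Z i := by
      refine DirectSum.linearMap_ext R fun j => LinearMap.ext fun z => ?_
      simp only [G, LinearMap.comp_apply, DirectSum.toModule_lof]
      by_cases h : i = j
      · subst h
        rw [htg, DirectSum.component.lof_self]
      · rw [htg' i j h, DirectSum.component.of, dif_neg (Ne.symm h)]
    exact LinearMap.congr_fun this x
  refine ⟨(LinearEquiv.ofBijective G ⟨?_, ?_⟩).symm⟩
  · rw [injective_iff_map_eq_zero]
    intro x hx
    ext i : 1
    rw [← hG i x, hx, map_zero]
    rfl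
  · intro x
    refine ⟨∑ i ∈ (hfin x).toFinset, DirectSum.lof R ι Z i (t i x), ?_⟩
    rw [← sub_eq_zero]
    refine hinj _ fun i => ?_
    rw [map_sub, hG, sub_eq_zero, DFinsupp.finsetSum_apply]
    by_cases h : i ∈ (hfin x).toFinset
    · rw [Finset.sum_eq_single_of_mem i h]
      · exact DirectSum.component.lof_self R i _
      · intro j _ hji
        exact DFinsupp.single_eq_of_ne (Ne.symm hji)
    · rw [Finset.sum_eq_zero]
      · by_contra h'
        exact h ((hfin x).mem_toFinset.2 (Ne.symm h'))
      · intro j hj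
        exact DFinsupp.single_eq_of_ne (fun hij => h (hij ▸ hj))

/-! ### Dimension bounds and top cycles -/

namespace DescChain

variable {P : Type u} [PartialOrder P] [GradeMinOrder ℕ P] {R : Type v} [CommRing R]

theorem length_le_of_grade_lt {k m : ℕ} {l : List P}
    (hl : l ∈ descLists {a : P | grade ℕ a < m} k) : k ≤ m := by
  induction k generalizing m l with
  | zero => exact Nat.zero_le m
  | succ k ih =>
    cases l with
    | nil => exact absurd hl.2.2 (by simp)
    | cons a l =>
      obtain ⟨ha, hl⟩ := cons_mem_descLists.1 hl
      have := ih (m := grade ℕ a) (descLists_mono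
        (fun b hb => show grade ℕ b < grade ℕ a from grade_strictMono hb.2) k hl)
      exact lt_of_le_of_lt this ha

theorem chains_grade_lt_eq_bot {k m : ℕ} (h : m < k) :
    chains R {a : P | grade ℕ a < m} k = ⊥ := by
  have : descLists {a : P | grade ℕ a < m} k = ∅ :=
    Set.eq_empty_of_forall_notMem fun l hl => (length_le_of_grade_lt hl).not_gt h
  rw [chains, this, Finsupp.supported_empty]

theorem Iio_subset_grade_lt {p : P} {m : ℕ} (h : grade ℕ p ≤ m) :
    Set.Iio p ⊆ {a : P | grade ℕ a < m} :=
  fun _ ha => (grade_strictMono ha).trans_le h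

/-- The top-dimensional reduced cycles of `P_{< p}`. -/
noncomputable def topCycles (R : Type v) [CommRing R] (p : P) : Submodule R (List P →₀ R) :=
  chains R (Set.Iio p) (grade ℕ p) ⊓ LinearMap.ker (boundary R)

theorem mem_topCycles {p : P} {x : List P →₀ R} :
    x ∈ topCycles R p ↔ x ∈ chains R (Set.Iio p) (grade ℕ p) ∧ boundary R x = 0 := Iff.rfl

end DescChain

/-! ### Homology of `P_{<p}` from a local covering family -/

namespace LocalCoveringFamily

open DescChain

variable {P : Type u} [PartialOrder P] [GradeMinOrder ℕ P] (𝒦 : LocalCoveringFamily P)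

/-- The elements of dimension `n` in `K_p`. -/
def level (p : P) (n : ℕ) : Set P := {q : P | (q : WithBot P) ∈ 𝒦.K p ∧ grade ℕ q = n}

/-- Take `f = η_p` on `K_p`, the identity elsewhere, and `v = η_p(0̂)`. Deleting level `n` of `K_p`
is what keeps `f` below `p`: `η_p` raises dimension by one, so it can reach `dim p = n + 1` only
from that level. -/
theorem exists_closure {p : P} {n : ℕ} (hp : grade ℕ p = n + 1) :
    ∃ (f : P → P) (v : P), v ∈ Set.Iio p \ 𝒦.level p n ∧
      (∀ a ∈ Set.Iio p \ 𝒦.level p n, f a ∈ Set.Iio p \ 𝒦.level p n) ∧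
      (∀ a ∈ Set.Iio p \ 𝒦.level p n, a ≤ f a) ∧
      (∀ a ∈ Set.Iio p \ 𝒦.level p n, ∀ b ∈ Set.Iio p \ 𝒦.level p n, a ≤ b → f a ≤ f b) ∧
      ∀ a ∈ Set.Iio p \ 𝒦.level p n, v ≤ f a := by
  have hcoe : ∀ q : 𝒦.K p, ∃ b : P, (b : WithBot P) = 𝒦.η p q := fun q =>
    WithBot.ne_bot_iff_exists.1 (ne_bot_of_gt (𝒦.lt_η p q))
  choose e he using hcoe
  have heK : ∀ q, ((e q : P) : WithBot P) ∉ 𝒦.K p := fun q => he q ▸ (𝒦.η p q).2.2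
  have hep : ∀ q, e q ≤ p := fun q => WithBot.coe_le_coe.1 (he q ▸ (𝒦.η p q).2.1)
  have hmem : ∀ b : P, (b : WithBot P) ∉ 𝒦.K p → b ≤ p → grade ℕ b ≤ n →
      b ∈ Set.Iio p \ 𝒦.level p n := by
    intro b hb hbp hbn
    refine ⟨lt_of_le_of_ne hbp ?_, fun h => hb h.1⟩
    rintro rfl
    omega
  classical
  let f : P → P := fun a => if h : (a : WithBot P) ∈ 𝒦.K p then e ⟨a, h⟩ else a
  have hfpos : ∀ (a : P) (h : (a : WithBot P) ∈ 𝒦.K p), f a = e ⟨a, h⟩ := fun a h => dif_pos h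
  have hfneg : ∀ a : P, (a : WithBot P) ∉ 𝒦.K p → f a = a := fun a h => dif_neg h
  have hfK : ∀ a, (f a : WithBot P) ∉ 𝒦.K p := by
    intro a
    by_cases h : (a : WithBot P) ∈ 𝒦.K p
    · rw [hfpos a h]
      exact heK _
    · rwa [hfneg a h]
  have hle : ∀ a, a ≤ f a := by
    intro a
    by_cases h : (a : WithBot P) ∈ 𝒦.K p
    · rw [hfpos a h, ← WithBot.coe_le_coe, he]
      exact (𝒦.lt_η p ⟨a, h⟩).le
    · rw [hfneg a h]
  have hfA : ∀ a ∈ Set.Iio p \ 𝒦.level p n, f a ∈ Set.Iio p \ 𝒦.level p n := by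
    intro a ha
    by_cases h : (a : WithBot P) ∈ 𝒦.K p
    · refine hmem _ (hfK a) ?_ ?_
      · rw [hfpos a h]
        exact hep _
      · have h₁ : grade ℕ a < grade ℕ p := grade_strictMono ha.1
        have h₂ : grade ℕ a ≠ n := fun h' => ha.2 ⟨h, h'⟩
        have h₃ := 𝒦.dim_η p ⟨a, h⟩
        rw [← he, ← hfpos a h] at h₃
        simp only [hatDim] at h₃
        omega
    · rwa [hfneg a h]
  refine ⟨f, e ⟨⊥, 𝒦.bot_mem p⟩, ?_, hfA, fun a _ => hle a, ?_, ?_⟩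
  · refine hmem _ (heK _) (hep _) ?_
    have h := 𝒦.dim_η p ⟨⊥, 𝒦.bot_mem p⟩
    rw [← he] at h
    simp only [hatDim] at h
    omega
  · intro a _ b hb hab
    by_cases h : (a : WithBot P) ∈ 𝒦.K p
    · rw [hfpos a h, ← WithBot.coe_le_coe, he]
      -- Condition (5) is applied to `f b` instead of `b`, since `b` itself may lie in `K_p`.
      exact 𝒦.η_le p ⟨a, h⟩ _ (hfK b) (WithBot.coe_le_coe.2 (hab.trans (hle b)))
        (WithBot.coe_le_coe.2 (hfA b hb).1.le)
    · rw [hfneg a h]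
      exact hab.trans (hle b)
  · intro a ha
    rw [← WithBot.coe_le_coe, he]
    exact 𝒦.η_le p _ _ (hfK a) bot_le (WithBot.coe_le_coe.2 (hfA a ha).1.le)

variable (R : Type v) [CommRing R]

theorem exists_primitive {p : P} {n : ℕ} (hp : grade ℕ p = n + 1) (k : ℕ) :
    ∃ H : (List P →₀ R) →ₗ[R] (List P →₀ R),
      (∀ x ∈ chains R (Set.Iio p \ 𝒦.level p n) k,
        H x ∈ chains R (Set.Iio p \ 𝒦.level p n) (k + 1)) ∧
      ∀ x ∈ chains R (Set.Iio p \ 𝒦.level p n) k, boundary R x = 0 → boundary R (H x) = x := by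
  obtain ⟨f, v, hv, hfA, hle, hmono, hvf⟩ := 𝒦.exists_closure hp
  exact DescChain.exists_primitive hv hfA hle hmono hvf k

theorem level_subset_Iio {p : P} {n : ℕ} (hp : grade ℕ p = n + 1) : 𝒦.level p n ⊆ Set.Iio p := by
  intro q hq
  refine lt_of_le_of_ne (WithBot.coe_le_coe.1 (𝒦.K_subset p hq.1)) ?_
  rintro rfl
  have := hq.2
  omega

theorem not_lt_of_mem_level {p q b : P} {n : ℕ} (hp : grade ℕ p = n + 1)
    (hq : q ∈ 𝒦.level p n) (hb : b < p) : ¬ q < b := by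
  intro h
  have h₁ : grade ℕ q < grade ℕ b := grade_strictMono h
  have h₂ : grade ℕ b < grade ℕ p := grade_strictMono hb
  have h₃ := hq.2
  omega

theorem Iio_subset_of_mem_level {p q : P} {n : ℕ} (hp : grade ℕ p = n + 1)
    (hq : q ∈ 𝒦.level p n) : Set.Iio q ⊆ Set.Iio p \ 𝒦.level p n := fun _ hb =>
  ⟨lt_trans hb (𝒦.level_subset_Iio hp hq), fun hb' =>
    𝒦.not_lt_of_mem_level hp hb' (𝒦.level_subset_Iio hp hq) hb⟩

/-- The reduced homology of `P_{< p}` vanishes below the top degree. -/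
theorem exists_boundary_eq (𝒦 : LocalCoveringFamily P) {m : ℕ} {p : P} (hp : grade ℕ p = m)
    {k : ℕ} (hk : k < m)
    {x : List P →₀ R} (hx : x ∈ chains R (Set.Iio p) k) (hx0 : boundary R x = 0) :
    ∃ y ∈ chains R (Set.Iio p) (k + 1), boundary R y = x := by
  induction m generalizing p k x with
  | zero => omega
  | succ n ih =>
    have hunion : Set.Iio p \ 𝒦.level p n ∪ 𝒦.level p n = Set.Iio p :=
      Set.sdiff_union_of_subset (𝒦.level_subset_Iio hp)
    have hacyc : ∀ k, ∀ z ∈ chains R (Set.Iio p \ 𝒦.level p n) k, boundary R z = 0 →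
        ∃ y ∈ chains R (Set.Iio p) (k + 1), boundary R y = z := by
      intro k z hz hz0
      obtain ⟨H, hH₁, hH₂⟩ := 𝒦.exists_primitive R hp k
      exact ⟨H z, chains_mono Set.sdiff_subset _ (hH₁ z hz), hH₂ z hz hz0⟩
    cases k with
    -- With no vertices, `x` is a multiple of the empty list; its primitive exists because `A` is
    -- nonempty.
    | zero => exact hacyc 0 x (by rwa [chains_zero_eq (R := R) _ (Set.Iio p)]) hx0
    | succ k =>
      obtain ⟨y, hy, hxy⟩ := exists_sub_boundary_mem (R := R) (k := k) (x := x)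
        (B := Set.Iio p \ 𝒦.level p n) (T := 𝒦.level p n)
        (fun q hq b hb => 𝒦.not_lt_of_mem_level hp hq (hunion.subset hb))
        (fun q hq hqB => hqB.2 hq)
        (fun q hq => 𝒦.Iio_subset_of_mem_level hp hq)
        (fun q hq z hz hz0 => ih hq.2 (by omega) hz hz0)
        (by rwa [hunion]) (by rw [hx0]; exact zero_mem _)
      rw [hunion] at hy
      obtain ⟨w, hw, hwx⟩ := hacyc _ _ hxy (by rw [map_sub, hx0, boundary_boundary, sub_zero])
      exact ⟨y + w, add_mem hy hw, by rw [map_add, hwx]; abel⟩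

/-- Taking tails identifies the top cycles of `P_{< p}` with those of the `P_{< q}`, for `q` in the
top level of `K_p`. -/
theorem nonempty_topCycles_equiv_directSum {p : P} {n : ℕ} (hp : grade ℕ p = n + 1) :
    Nonempty (topCycles R p ≃ₗ[R] ⨁ q : 𝒦.level p n, topCycles R (q : P)) := by
  have hunion : Set.Iio p \ 𝒦.level p n ∪ 𝒦.level p n = Set.Iio p :=
    Set.sdiff_union_of_subset (𝒦.level_subset_Iio hp)
  have hmax : ∀ q ∈ 𝒦.level p n, ∀ b ∈ Set.Iio p, ¬ q < b := fun q hq b hb =>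
    𝒦.not_lt_of_mem_level hp hq hb
  obtain ⟨H, hH₁, hH₂⟩ := 𝒦.exists_primitive R hp n
  have htail : ∀ q : 𝒦.level p n, ∀ x ∈ topCycles R p, tail R (q : P) x ∈ topCycles R (q : P) := by
    rintro ⟨q, hq⟩ x ⟨hx, hx0 : boundary R x = 0⟩
    rw [hp] at hx
    refine mem_topCycles.2 ⟨?_, ?_⟩
    · rw [hq.2]
      exact chains_mono Set.inter_subset_right _ (tail_mem_chains q hx)
    · rw [← neg_eq_zero, ← tail_boundary (hmax q hq) hx, hx0, map_zero]
  have hA : ∀ q : 𝒦.level p n, ∀ z ∈ topCycles R (q : P),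
      z ∈ chains R (Set.Iio p \ 𝒦.level p n) n := by
    rintro ⟨q, hq⟩ z ⟨hz, -⟩
    rw [hq.2] at hz
    exact chains_mono (𝒦.Iio_subset_of_mem_level hp hq) _ hz
  -- The cone `q :: z` and the filling `H z` inside `A` both have boundary `z`, so their difference
  -- is a cycle. `H z` avoids the top level, so the tail at `q` is still `z`.
  have hsec : ∀ q : 𝒦.level p n, ∀ z ∈ topCycles R (q : P),
      (cons R (q : P) - H) z ∈ topCycles R p := by
    rintro ⟨q, hq⟩ z hz
    have hzA := hA ⟨q, hq⟩ z hz
    obtain ⟨hz, hz0 : boundary R z = 0⟩ := hz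
    refine mem_topCycles.2 ⟨?_, ?_⟩
    · rw [hp, LinearMap.sub_apply]
      refine sub_mem ?_ (chains_mono Set.sdiff_subset _ (hH₁ z hzA))
      have hsub : Set.Iio q ⊆ Set.Iio p ∩ Set.Iio q := fun b hb =>
        ⟨lt_trans hb (𝒦.level_subset_Iio hp hq), hb⟩
      rw [hq.2] at hz
      exact cons_mem_chains (𝒦.level_subset_Iio hp hq) (chains_mono hsub _ hz)
    · rw [LinearMap.sub_apply, map_sub, boundary_cons, hH₂ z hzA hz0, hz0]
      simp
  have htailH : ∀ q q' : 𝒦.level p n, ∀ z ∈ topCycles R (q' : P), tail R (q : P) (H z) = 0 :=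
    fun q q' z hz => tail_eq_zero_of_notMem (fun h => h.2 q.2) (hH₁ z (hA q' z hz))
  refine nonempty_linearEquiv_directSum
    (R := R) (N := topCycles R p) (Z := fun q : 𝒦.level p n => topCycles R (q : P))
    (fun q => (cons R (q : P) - H).restrict (hsec q)) (fun q => (tail R (q : P)).restrict (htail q))
    (fun q z => ?_) (fun q q' hqq' z => ?_) (fun x hx => ?_) fun x => ?_
  · ext1
    simp [htailH q q z z.2]
  · ext1
    have : (q : P) ≠ q' := fun h => hqq' (Subtype.ext h)
    simp [htailH q q' z z.2, tail_cons_of_ne this]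
  · obtain ⟨x, hx', hx0 : boundary R x = 0⟩ := x
    rw [hp, ← hunion] at hx'
    have hxA := mem_chains_of_tail_eq_zero (fun q hq b hb => hmax q hq b (hunion.subset hb)) hx'
      fun q hq => congrArg Subtype.val (hx ⟨q, hq⟩)
    obtain ⟨H', hH'₁, hH'₂⟩ := 𝒦.exists_primitive R hp (n + 1)
    -- With all tails zero, `x` is a cycle in the acyclic `A`. Its primitive has `n + 2` vertices,
    -- but only the dimensions `0, …, n` occur, so the primitive is zero and so is `x`.
    have h₁ := chains_mono (Set.sdiff_subset.trans (Iio_subset_grade_lt hp.le)) _ (hH'₁ x hxA)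
    rw [chains_grade_lt_eq_bot (by omega), Submodule.mem_bot] at h₁
    have h₂ := hH'₂ x hxA hx0
    rw [h₁, map_zero] at h₂
    exact Subtype.ext h₂.symm
  · refine ((finite_tail_ne_zero (x : List P →₀ R)).preimage
      Subtype.val_injective.injOn).subset fun q hq => ?_
    intro h
    exact hq (Subtype.ext h)

theorem finite_level (hfin : ∀ p : P, (Set.Iic p).Finite) (p : P) (n : ℕ) :
    (𝒦.level p n).Finite :=
  (hfin p).subset fun _ hq => WithBot.coe_le_coe.1 (𝒦.K_subset p hq.1)

/-- The top cycles of `P_{< p}` form a free module of rank `K^p_n`, where `n = dim p`. -/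
theorem nonempty_topCycles_equiv (hfin : ∀ p : P, (Set.Iic p).Finite) {n : ℕ} {p : P}
    (hp : grade ℕ p = n) : Nonempty (topCycles R p ≃ₗ[R] (Fin (𝒦.num n p) → R)) := by
  induction n generalizing p with
  | zero =>
    have htop : topCycles R p = Finsupp.supported R R {([] : List P)} := by
      ext x
      rw [mem_topCycles, hp]
      constructor
      · rintro ⟨hx, -⟩
        rwa [chains, descLists_zero] at hx
      · intro hx
        rw [← descLists_zero (Set.Iio p)] at hx
        exact ⟨hx, boundary_eq_zero_of_mem_chains_zero hx⟩
    rw [htop]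
    have e := (Finsupp.supportedEquivFinsupp (M := R) (R := R) {([] : List P)}).trans
      (Finsupp.uniqueLinearEquiv R R ⟨[], rfl⟩)
    exact ⟨e.trans (LinearEquiv.funUnique (Fin 1) R R).symm⟩
  | succ n ih =>
    obtain ⟨e⟩ := 𝒦.nonempty_topCycles_equiv_directSum R hp
    have hq : ∀ q : 𝒦.level p n, Nonempty (topCycles R (q : P) ≃ₗ[R] (Fin (𝒦.num n q) → R)) :=
      fun q => ih q.2.2
    let e' := fun q => (hq q).some
    classical
    have := (𝒦.finite_level hfin p n).fintype
    have hcard : Fintype.card (Σ q : 𝒦.level p n, Fin (𝒦.num n q)) = 𝒦.num (n + 1) p := by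
      rw [Fintype.card_sigma]
      simp only [Fintype.card_fin, num]
      rw [← finsum_eq_sum_of_fintype]
      exact finsum_set_coe_eq_finsum_mem (f := fun q => 𝒦.num n q) (𝒦.level p n)
    exact ⟨e.trans <| (DFinsupp.mapRange.linearEquiv e').trans <|
      (DirectSum.linearEquivFunOnFintype R _ _).trans <|
      (LinearEquiv.piCurry R (fun (q : 𝒦.level p n) (_ : Fin (𝒦.num n q)) => R)).symm.trans <|
      LinearEquiv.funCongrLeft R R (Fintype.equivFinOfCardEq hcard).symm⟩

end LocalCoveringFamily

/-! ### The dimension filtration and cellular chains -/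

namespace DescChain

variable {P : Type u} [PartialOrder P] [GradeMinOrder ℕ P] (R : Type v) [CommRing R]

/-- The sums `x` of chains with `n + 1` vertices of dimension at most `n` such that the vertices of
the boundary of `x` have dimension less than `n`. -/
noncomputable def cellularChains (P : Type u) [PartialOrder P] [GradeMinOrder ℕ P] (R : Type v)
    [CommRing R] (n : ℕ) : Submodule R (List P →₀ R) :=
  chains R {a : P | grade ℕ a < n + 1} (n + 1) ⊓
    (chains R {a : P | grade ℕ a < n} n).comap (boundary R)

theorem mem_cellularChains {n : ℕ} {x : List P →₀ R} :
    x ∈ cellularChains P R n ↔ x ∈ chains R {a : P | grade ℕ a < n + 1} (n + 1) ∧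
      boundary R x ∈ chains R {a : P | grade ℕ a < n} n := Iff.rfl

theorem grade_lt_union_eq (n : ℕ) :
    {a : P | grade ℕ a < n} ∪ {a : P | grade ℕ a = n} = {a : P | grade ℕ a < n + 1} := by
  ext a
  simp only [Set.mem_union, Set.mem_ofPred_eq]
  omega

theorem not_lt_of_grade_eq {n : ℕ} {q b : P} (hq : grade ℕ q = n) (hb : grade ℕ b < n + 1) :
    ¬ q < b := by
  intro h
  have : grade ℕ q < grade ℕ b := grade_strictMono h
  omega

theorem nonempty_cellularChains_equiv (n : ℕ) :
    Nonempty (cellularChains P R n ≃ₗ[R] ⨁ p : {p : P // grade ℕ p = n}, topCycles R (p : P)) := by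
  have htail : ∀ p : {p : P // grade ℕ p = n}, ∀ x ∈ cellularChains P R n,
      tail R (p : P) x ∈ topCycles R (p : P) := by
    rintro ⟨p, hp⟩ x hxc
    obtain ⟨hx, hx'⟩ := (mem_cellularChains R).1 hxc
    refine mem_topCycles.2 ⟨?_, ?_⟩
    · rw [hp]
      exact chains_mono Set.inter_subset_right _ (tail_mem_chains p hx)
    · rw [← neg_eq_zero, ← tail_boundary (fun b hb => not_lt_of_grade_eq hp hb) hx]
      have hp' : p ∉ {a : P | grade ℕ a < n} := fun h => hp.not_lt h
      exact tail_eq_zero_of_notMem hp' hx'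
  -- No correction term is needed here: `∂ (p :: z) = z` already lies in dimensions below `n`.
  have hsec : ∀ p : {p : P // grade ℕ p = n}, ∀ z ∈ topCycles R (p : P),
      cons R (p : P) z ∈ cellularChains P R n := by
    rintro ⟨p, hp⟩ z ⟨hz, hz0 : boundary R z = 0⟩
    rw [hp] at hz
    refine (mem_cellularChains R).2 ⟨?_, ?_⟩
    · have hsub : Set.Iio p ⊆ {a : P | grade ℕ a < n + 1} ∩ Set.Iio p := fun b hb =>
        ⟨Iio_subset_grade_lt (hp.le.trans n.le_succ) hb, hb⟩
      have hp' : p ∈ {a : P | grade ℕ a < n + 1} := show grade ℕ p < n + 1 by omega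
      exact cons_mem_chains hp' (chains_mono hsub _ hz)
    · rw [boundary_cons, hz0, map_zero, sub_zero]
      exact chains_mono (Iio_subset_grade_lt hp.le) _ hz
  refine nonempty_linearEquiv_directSum (R := R) (N := cellularChains P R n)
    (Z := fun p : {p : P // grade ℕ p = n} => topCycles R (p : P))
    (fun p => (cons R (p : P)).restrict (hsec p)) (fun p => (tail R (p : P)).restrict (htail p))
    (fun p z => ?_) (fun p p' hpp' z => ?_) (fun x hx => ?_) fun x => ?_
  · ext1
    simp
  · ext1
    have : (p : P) ≠ p' := fun h => hpp' (Subtype.ext h)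
    simp [tail_cons_of_ne this]
  · obtain ⟨x, hx', _⟩ := x
    rw [← grade_lt_union_eq] at hx'
    have h := mem_chains_of_tail_eq_zero
      (fun q hq b hb => not_lt_of_grade_eq hq ((grade_lt_union_eq n).subset hb)) hx'
      fun q hq => congrArg Subtype.val (hx ⟨q, hq⟩)
    rw [chains_grade_lt_eq_bot (by omega), Submodule.mem_bot] at h
    exact Subtype.ext h
  · refine ((finite_tail_ne_zero (x : List P →₀ R)).preimage
      Subtype.val_injective.injOn).subset fun q hq => ?_
    intro h
    exact hq (Subtype.ext h)

/-- A formal sum involves finitely many elements, so the descent through the filtration has a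
starting point even when dimensions in `P` are unbounded. -/
theorem exists_mem_chains_grade_lt {k : ℕ} {x : List P →₀ R} (hx : x ∈ chains R Set.univ k) :
    ∃ m, x ∈ chains R {a : P | grade ℕ a < m} k := by
  classical
  let s : Finset P := x.support.biUnion List.toFinset
  refine ⟨s.sup (grade ℕ) + 1, fun l hl => ?_⟩
  have hl' := hx hl
  refine ⟨hl'.1, fun a ha => Nat.lt_succ_of_le (Finset.le_sup (f := grade ℕ) ?_), hl'.2.2⟩
  exact Finset.mem_biUnion.2 ⟨l, hl, by simpa using ha⟩

variable {R}

/-- Pushing a relative cycle down the dimension filtration. -/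
theorem exists_sub_boundary_mem_grade_lt (𝒦 : LocalCoveringFamily P) {n : ℕ} {x : List P →₀ R}
    (hx : x ∈ chains R Set.univ (n + 1))
    (hbx : boundary R x ∈ chains R {a : P | grade ℕ a < n} n) :
    ∃ y ∈ chains R (Set.univ : Set P) (n + 2),
      x - boundary R y ∈ chains R {a : P | grade ℕ a < n + 1} (n + 1) := by
  obtain ⟨m, hm⟩ := exists_mem_chains_grade_lt R hx
  clear hx
  induction m generalizing x with
  | zero =>
    refine ⟨0, zero_mem _, ?_⟩
    rw [map_zero, sub_zero]
    exact chains_mono (fun a (ha : grade ℕ a < 0) => absurd ha (Nat.not_lt_zero _)) _ hm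
  | succ m ih =>
    rcases le_or_gt m n with h | h
    · refine ⟨0, zero_mem _, ?_⟩
      rw [map_zero, sub_zero]
      refine chains_mono (fun a (ha : grade ℕ a < m + 1) => ?_) _ hm
      exact ha.trans_le (Nat.succ_le_succ h)
    -- Here `n < m`, so cycles with `n` vertices bound in each `P_{<q}` with `dim q = m`, and the
    -- elements of dimension `m` can be cleared from the chain.
    · rw [← grade_lt_union_eq] at hm
      have hsub : {a : P | grade ℕ a < n} ⊆ {a : P | grade ℕ a < m} :=
        fun a (ha : grade ℕ a < n) => ha.trans h
      obtain ⟨y, hy, hxy⟩ := exists_sub_boundary_mem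
        (fun q hq b hb => not_lt_of_grade_eq hq ((grade_lt_union_eq m).subset hb))
        (fun q (hq : grade ℕ q = m) (hqB : grade ℕ q < m) => by omega)
        (fun q hq => Iio_subset_grade_lt (le_of_eq hq))
        (fun q hq z hz hz0 => 𝒦.exists_boundary_eq R hq h hz hz0)
        hm (chains_mono hsub _ hbx)
      obtain ⟨w, hw, hxw⟩ := ih (x := x - boundary R y)
        (by rwa [map_sub, boundary_boundary, sub_zero]) hxy
      refine ⟨y + w, add_mem (chains_mono (Set.subset_univ _) _ hy) hw, ?_⟩
      rwa [map_add, ← sub_sub]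

variable (R) in
theorem boundary_single_ofFn {α : Type*} {n : ℕ} (g : Fin (n + 1) → α) :
    boundary R (Finsupp.single (List.ofFn g) 1) =
      ∑ i : Fin (n + 1), (-1 : R) ^ (i : ℕ) •
        Finsupp.single (List.ofFn fun j => g (i.succAbove j)) 1 := by
  induction n with
  | zero =>
    rw [List.ofFn_succ, ← cons_single, boundary_cons]
    simp
  | succ n ih =>
    rw [List.ofFn_succ, ← cons_single, boundary_cons, ih, Fin.sum_univ_succ (n := n + 1),
      sub_eq_add_neg, map_sum, ← Finset.sum_neg_distrib]
    congr 1
    · simp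
    · refine Finset.sum_congr rfl fun i _ => ?_
      rw [map_smul, cons_single, ← neg_smul, List.ofFn_succ (f := fun j => g (i.succ.succAbove j))]
      simp [pow_succ]

end DescChain

/-! ### Comparison with simplicial chains of the order complex -/

namespace OrderComplex

open DescChain

section

variable {P : Type u} [PartialOrder P] {R : Type v} [CommRing R] {n : ℕ}

/-- The vertices of a simplex, in decreasing order. -/
def Simplex.toList (c : Simplex P n) : List P := List.ofFn fun i => c i.rev

theorem Simplex.toList_injective : Function.Injective (Simplex.toList (P := P) (n := n)) := by
  intro c c' h
  have h' := List.ofFn_injective h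
  ext i
  simpa using congrFun h' i.rev

theorem Simplex.range_toList :
    Set.range (Simplex.toList (P := P) (n := n)) = descLists Set.univ (n + 1) := by
  ext l
  constructor
  · rintro ⟨c, rfl⟩
    refine ⟨?_, by simp, by simp [Simplex.toList]⟩
    rw [Simplex.toList, List.pairwise_ofFn]
    intro i j hij
    exact c.strictMono (Fin.rev_lt_rev.2 hij)
  · rintro ⟨h, -, hl⟩
    obtain ⟨g, rfl⟩ : ∃ g : Fin (n + 1) → P, List.ofFn g = l :=
      ⟨fun i => l.get (i.cast hl.symm),
        List.ext_getElem (by simp [hl]) fun i _ _ => by simp [-List.ofFn_succ]⟩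
    rw [List.pairwise_ofFn] at h
    refine ⟨OrderEmbedding.ofStrictMono (fun i => g i.rev) fun i j hij =>
      h (Fin.rev_lt_rev.2 hij), ?_⟩
    exact congrArg List.ofFn (funext fun i => congrArg g (Fin.rev_rev i))

variable (P R n) in
/-- The identification of simplicial chains with formal sums of decreasing lists. -/
noncomputable def toChains : (Simplex P n →₀ R) →ₗ[R] (List P →₀ R) :=
  Finsupp.lmapDomain R R Simplex.toList

theorem toChains_injective : Function.Injective (toChains P R n) :=
  Finsupp.mapDomain_injective Simplex.toList_injective

theorem range_toChains : LinearMap.range (toChains P R n) = chains R Set.univ (n + 1) := by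
  rw [chains, ← Simplex.range_toList, ← Set.image_univ, ← Finsupp.lmapDomain_supported,
    Finsupp.supported_univ, Submodule.map_top]
  rfl

theorem toChains_mem (x : Simplex P n →₀ R) : toChains P R n x ∈ chains R Set.univ (n + 1) :=
  range_toChains (R := R) (P := P) (n := n) ▸ LinearMap.mem_range_self _ x

/-- Listing vertices in decreasing order moves `p_i` to position `n + 1 - i`, which accounts for a
global sign. It depends only on the degree, so cycles and boundaries are unaffected. -/
theorem boundary_toChains (x : Simplex P (n + 1) →₀ R) :
    DescChain.boundary R (toChains P R (n + 1) x) =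
      (-1 : R) ^ (n + 1) • toChains P R n (boundary P R n x) := by
  have : DescChain.boundary R ∘ₗ toChains P R (n + 1) =
      (-1 : R) ^ (n + 1) • (toChains P R n ∘ₗ boundary P R n) := by
    apply Finsupp.lhom_ext'
    intro c
    ext1
    simp only [LinearMap.comp_apply, LinearMap.smul_apply, Finsupp.lsingle_apply, toChains,
      boundary, LinearMap.sum_apply, Finsupp.lmapDomain_apply, Finsupp.mapDomain_single, map_sum,
      map_smul, Finset.smul_sum, smul_smul]
    rw [Simplex.toList, boundary_single_ofFn, ← Equiv.sum_comp Fin.revPerm]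
    refine Finset.sum_congr rfl fun i _ => ?_
    congr 1
    · rw [Fin.revPerm_apply, Fin.val_rev]
      obtain ⟨k, hk⟩ := Nat.exists_eq_add_of_le (Nat.le_of_lt_succ i.is_lt)
      have h₁ : n + 1 + 1 - (i + 1) = k := by omega
      rw [h₁, hk, pow_add, mul_right_comm, ← mul_pow]
      simp
    · congr 1
      simp only [Simplex.toList, face, Fin.revPerm_apply, Fin.rev_succAbove, Fin.rev_rev]
      rfl
  exact LinearMap.congr_fun this x

end

end OrderComplex

/-- A morphism of short complexes of modules, injective on the right, induces an isomorphism in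
homology as soon as cycles lift up to boundaries and boundaries lift to boundaries. -/
theorem CategoryTheory.ShortComplex.nonempty_homology_iso_of_moduleCat {R : Type v} [Ring R]
    {S T : ShortComplex (ModuleCat.{max u v} R)} (φ : S ⟶ T)
    (hφ : Function.Injective φ.τ₃)
    (hsurj : ∀ z : T.X₂, T.g z = 0 → ∃ (y : S.X₂) (w : T.X₁), z - φ.τ₂ y = T.f w)
    (hinj : ∀ y : S.X₂, S.g y = 0 → (∃ w : T.X₁, φ.τ₂ y = T.f w) → ∃ u : S.X₁, S.f u = y) :
    Nonempty (S.homology ≅ T.homology) := by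
  have hg : ∀ y : S.X₂, T.g (φ.τ₂ y) = φ.τ₃ (S.g y) := fun y =>
    ConcreteCategory.congr_hom φ.comm₂₃ y
  have hf : ∀ y : S.X₁, T.f (φ.τ₁ y) = φ.τ₂ (S.f y) := fun y =>
    ConcreteCategory.congr_hom φ.comm₁₂ y
  let k : LinearMap.ker S.g.hom →ₗ[R] LinearMap.ker T.g.hom :=
    φ.τ₂.hom.restrict fun y (hy : S.g y = 0) => by
      change T.g (φ.τ₂ y) = 0
      rw [hg, hy, map_zero]
  have hk : LinearMap.range S.moduleCatToCycles ≤
      (LinearMap.range T.moduleCatToCycles).comap k := by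
    rintro _ ⟨u, rfl⟩
    exact ⟨φ.τ₁ u, Subtype.ext (hf u)⟩
  let e := LinearEquiv.ofBijective
    ((LinearMap.range S.moduleCatToCycles).mapQ (LinearMap.range T.moduleCatToCycles) k hk) (by
      constructor
      · rw [injective_iff_map_eq_zero]
        intro y
        obtain ⟨⟨y, hy⟩, rfl⟩ := Submodule.Quotient.mk_surjective _ y
        rw [Submodule.mapQ_apply, Submodule.Quotient.mk_eq_zero, Submodule.Quotient.mk_eq_zero]
        rintro ⟨w, hw⟩
        obtain ⟨u, hu⟩ := hinj y hy ⟨w, (congrArg Subtype.val hw).symm⟩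
        exact ⟨u, Subtype.ext hu⟩
      · intro z
        obtain ⟨⟨z, hz⟩, rfl⟩ := Submodule.Quotient.mk_surjective _ z
        obtain ⟨y, w, hw⟩ := hsurj z hz
        have hy : S.g y = 0 := by
          -- `φ y` differs from the cycle `z` by a boundary, so it is a cycle; injectivity in the
          -- third term then makes `y` one.
          apply hφ
          have hz' : T.g z = 0 := hz
          rw [← hg, map_zero, ← sub_sub_cancel z (φ.τ₂ y), hw, map_sub, hz', T.moduleCat_zero_apply,
            sub_zero]
        refine ⟨Submodule.Quotient.mk ⟨y, hy⟩, ?_⟩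
        rw [Submodule.mapQ_apply, eq_comm, Submodule.Quotient.eq]
        exact ⟨w, Subtype.ext hw.symm⟩)
  exact ⟨S.moduleCatHomologyIso ≪≫ e.toModuleIso ≪≫ T.moduleCatHomologyIso.symm⟩

/-! ### The cellular complex and its homology -/

namespace OrderComplex

open DescChain

variable (P : Type u) [PartialOrder P] (R : Type v) [CommRing R]

theorem chainComplex_d (n : ℕ) :
    (chainComplex P R).d (n + 1) n = ModuleCat.ofHom (boundary P R n) :=
  ChainComplex.of_d (fun n => ModuleCat.of R (Simplex P n →₀ R))
    (fun n => ModuleCat.ofHom (boundary P R n)) n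

variable [GradeMinOrder ℕ P]

/-- The simplicial `n`-chains of dimension filtration `n` with boundary in filtration `n - 1`. -/
noncomputable def cellular (n : ℕ) : Submodule R (Simplex P n →₀ R) :=
  (cellularChains P R n).comap (toChains P R n)

variable {P R} in
theorem boundary_mem_cellular {n : ℕ} {x : Simplex P (n + 1) →₀ R} (hx : x ∈ cellular P R (n + 1)) :
    boundary P R n x ∈ cellular P R n := by
  have h := boundary_toChains x
  have h' : toChains P R n (boundary P R n x) =
      (-1 : R) ^ (n + 1) • DescChain.boundary R (toChains P R (n + 1) x) := by
    rw [h, smul_smul, ← mul_pow]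
    simp
  have hx' : _ ∧ _ := hx
  change toChains P R n _ ∈ cellularChains P R n
  rw [h', mem_cellularChains, map_smul, DescChain.boundary_boundary, smul_zero]
  exact ⟨Submodule.smul_mem _ _ hx'.2, zero_mem _⟩

-- This serves both halves of the homology comparison: applied to a cycle it gives surjectivity, and
-- applied to a chain whose boundary is cellular it gives injectivity.
variable {P R} in
theorem exists_sub_boundary_mem_cellular (𝒦 : LocalCoveringFamily P) {n : ℕ}
    {z : Simplex P n →₀ R}
    (hz : DescChain.boundary R (toChains P R n z) ∈ chains R {a : P | grade ℕ a < n} n) :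
    ∃ w : Simplex P (n + 1) →₀ R, z - boundary P R n w ∈ cellular P R n := by
  obtain ⟨y, hy, hzy⟩ := exists_sub_boundary_mem_grade_lt 𝒦 (toChains_mem z) hz
  rw [← range_toChains] at hy
  obtain ⟨w, rfl⟩ := hy
  refine ⟨(-1 : R) ^ (n + 1) • w, ?_⟩
  have h : toChains P R n (z - boundary P R n ((-1 : R) ^ (n + 1) • w)) =
      toChains P R n z - DescChain.boundary R (toChains P R (n + 1) w) := by
    rw [boundary_toChains, map_sub, map_smul, map_smul]
  change toChains P R n _ ∈ cellularChains P R n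
  rw [h]
  refine (mem_cellularChains R).2 ⟨hzy, ?_⟩
  rwa [map_sub, DescChain.boundary_boundary, sub_zero]

/-- The cellular chain complex of the dimension filtration, as a subcomplex of the simplicial chain
complex. -/
noncomputable def cellularComplex : ChainComplex (ModuleCat.{max u v} R) ℕ :=
  ChainComplex.of (fun n => ModuleCat.of R (cellular P R n))
    (fun n => ModuleCat.ofHom ((boundary P R n).restrict fun _ hx => boundary_mem_cellular hx))
    (fun n => by
      rw [← ModuleCat.ofHom_comp]
      refine ModuleCat.hom_ext (LinearMap.ext fun x => ?_)
      exact Subtype.ext (LinearMap.congr_fun (OrderComplex.boundary_boundary P R n) x))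

theorem cellularComplex_d (n : ℕ) :
    (cellularComplex P R).d (n + 1) n =
      ModuleCat.ofHom ((boundary P R n).restrict fun _ hx => boundary_mem_cellular hx) :=
  ChainComplex.of_d (fun n => ModuleCat.of R (cellular P R n))
    (fun n => ModuleCat.ofHom ((boundary P R n).restrict fun _ hx => boundary_mem_cellular hx)) n

/-- The inclusion of the cellular chain complex. -/
noncomputable def cellularInclusion : cellularComplex P R ⟶ chainComplex P R :=
  ChainComplex.ofHom (X := cellularComplex P R) (Y := chainComplex P R)
    (fun n => ModuleCat.ofHom (cellular P R n).subtype) fun n => by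
      rw [chainComplex_d, cellularComplex_d]
      rfl

variable {P}

theorem nonempty_homology_cellularComplex_iso (𝒦 : LocalCoveringFamily P) (n : ℕ) :
    Nonempty ((cellularComplex P R).homology n ≅ homology P R n) := by
  have hprev : (ComplexShape.down ℕ).prev n = n + 1 := ChainComplex.prev ℕ n
  obtain ⟨k, hk⟩ : ∃ k, (ComplexShape.down ℕ).next n = k := ⟨_, rfl⟩
  have hcyc : ∀ z : Simplex P n →₀ R, (chainComplex P R).d n k z = 0 →
      DescChain.boundary R (toChains P R n z) ∈ chains R {a : P | grade ℕ a < n} n := by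
    intro z hz
    cases n with
    | zero =>
      -- In degree `0` the augmented boundary consists of multiples of the empty list, so the
      -- dimension condition is vacuous.
      rw [chains_zero_eq _ Set.univ]
      exact boundary_mem_chains (toChains_mem z)
    | succ n =>
      obtain rfl : n = k := by rw [← hk, ChainComplex.next_nat_succ]
      rw [chainComplex_d] at hz
      have hz' : boundary P R n z = 0 := hz
      rw [boundary_toChains, hz', map_zero, smul_zero]
      exact zero_mem _
  have hsurj : ∀ z : Simplex P n →₀ R, (chainComplex P R).d n k z = 0 →
      ∃ (y : cellular P R n) (w : Simplex P (n + 1) →₀ R),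
        z - (y : Simplex P n →₀ R) = (chainComplex P R).d (n + 1) n w := by
    intro z hz
    obtain ⟨w, hw⟩ := exists_sub_boundary_mem_cellular 𝒦 (hcyc z hz)
    refine ⟨⟨_, hw⟩, w, ?_⟩
    rw [chainComplex_d]
    exact sub_sub_cancel z _
  have hinj : ∀ (y : cellular P R n) (w : Simplex P (n + 1) →₀ R),
      (y : Simplex P n →₀ R) = (chainComplex P R).d (n + 1) n w →
        ∃ u : cellular P R (n + 1), (cellularComplex P R).d (n + 1) n u = y := by
    rintro ⟨y, hy⟩ w hw
    rw [chainComplex_d] at hw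
    obtain rfl : y = boundary P R n w := hw
    -- Replacing `w` by a cellular chain differing from it by a boundary leaves `∂w` unchanged.
    obtain ⟨u, hu⟩ := exists_sub_boundary_mem_cellular 𝒦 (z := w) (by
      rw [boundary_toChains]
      exact Submodule.smul_mem _ _ ((mem_cellularChains R).1 hy).1)
    refine ⟨⟨_, hu⟩, ?_⟩
    rw [cellularComplex_d]
    refine Subtype.ext ?_
    change boundary P R n (w - boundary P R (n + 1) u) = boundary P R n w
    rw [map_sub, sub_eq_self]
    exact LinearMap.congr_fun (OrderComplex.boundary_boundary P R n) u
  suffices h : Nonempty (((cellularComplex P R).sc' (n + 1) n k).homology ≅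
      ((chainComplex P R).sc' (n + 1) n k).homology) by
    obtain ⟨e⟩ := h
    exact ⟨(cellularComplex P R).homologyIsoSc' (n + 1) n k hprev hk ≪≫ e ≪≫
      ((chainComplex P R).homologyIsoSc' (n + 1) n k hprev hk).symm⟩
  exact ShortComplex.nonempty_homology_iso_of_moduleCat
    ((HomologicalComplex.shortComplexFunctor' (ModuleCat.{max u v} R) (ComplexShape.down ℕ)
      (n + 1) n k).map (cellularInclusion P R)) Subtype.val_injective hsurj
    fun y _ ⟨w, hw⟩ => hinj y w hw

theorem nonempty_cellularComplex_X_iso (hfin : ∀ p : P, (Set.Iic p).Finite)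
    (𝒦 : LocalCoveringFamily P) (n : ℕ) :
    Nonempty ((cellularComplex P R).X n ≅
      ModuleCat.of R (⨁ p : {p : P // grade ℕ p = n}, (Fin (𝒦.num n p) → R))) := by
  obtain ⟨e⟩ := nonempty_cellularChains_equiv (P := P) R n
  let e' := fun p : {p : P // grade ℕ p = n} => (𝒦.nonempty_topCycles_equiv R hfin p.2).some
  let t : cellular P R n ≃ₗ[R] cellularChains P R n :=
    LinearEquiv.ofBijective ((toChains P R n).restrict fun _ hx => hx) (by
      constructor
      · exact fun x y h => Subtype.ext (toChains_injective (congrArg Subtype.val h))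
      · rintro ⟨y, hy⟩
        have : y ∈ LinearMap.range (toChains P R n) := by
          rw [range_toChains]
          exact chains_mono (Set.subset_univ _) _ hy.1
        obtain ⟨x, rfl⟩ := this
        exact ⟨⟨x, hy⟩, rfl⟩)
  exact ⟨(t.trans (e.trans (DFinsupp.mapRange.linearEquiv e'))).toModuleIso⟩

end OrderComplex

theorem theorem1 {P : Type u} [PartialOrder P] [GradeMinOrder ℕ P]
    (hfin : ∀ p : P, (Set.Iic p).Finite) (𝒦 : LocalCoveringFamily P)
    (R : Type v) [CommRing R] :
    ∃ C : ChainComplex (ModuleCat.{max u v} R) ℕ,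
      (∀ n : ℕ, Nonempty (C.X n ≅
        ModuleCat.of R (⨁ p : {p : P // grade ℕ p = n}, (Fin (𝒦.num n p) → R)))) ∧
      (∀ n : ℕ, Nonempty (C.homology n ≅ OrderComplex.homology P R n)) :=
  ⟨OrderComplex.cellularComplex P R,
    OrderComplex.nonempty_cellularComplex_X_iso R hfin 𝒦,
    OrderComplex.nonempty_homology_cellularComplex_iso R 𝒦⟩
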